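/- Fix an integer $T\ge 1$ and consider a sequence, indexed by $k=1,2,\dots$, of batched adaptive experiments, each with $T$ periods and two arms $a\in\{0,1\}$ (control and treatment). Suppress $k$ in the notation. In period $t$ a random number $N_{a,t}$ of units is in arm $a$, and the $i$-th of them has the outcome $Y_{i,t}(a)=\mu_{a,t}+\varepsilon_{i,t}(a)$, where $\mu_{1,t}-\mu_{0,t}=\Delta$ for every $t$. The arm sizes may depend in any way on past data. In each period $t$ the errors $\varepsilon_{i,t}(a)$ of the two arms are mutually independent; those of arm $a$ are identically distributed with a law that does not depend on $k$ and has mean $0$ and variance $\sigma_{a,t}^2\in(0,\infty)$; and, jointly, the errors of period $t$ are independent of the observed outcomes of the earlier periods together with the arm sizes $N_{a,s}$, $s\le t$. Assume that the batches are large: $N_{a,t}\to\infty$ in probability as $k\to\infty$, for every $a$ and $t$. Let $\hat\sigma_{a,t}^2$ be consistent estimators, $\hat\sigma_{a,t}^2\to\sigma_{a,t}^2$ in probability. With $\hat\Delta_t=\bar Y_{1,t}-\bar Y_{0,t}$ the difference in sample means of period $t$, put $$\hat v_t=\frac{\hat\sigma_{1,t}^2}{N_{1,t}}+\frac{\hat\sigma_{0,t}^2}{N_{0,t}},\quad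 \hat w_t=\frac1{\sqrt{\hat v_t}},\quad \hat S=\sum_{t=1}^T\hat w_t,\quad \hat\Delta_F=\sum_{t=1}^T\frac{\hat w_t}{\hat S}\,\hat\Delta_t,\quad \operatorname{SE}(\hat\Delta_F)=\frac{\sqrt T}{\hat S}.$$ Then for every $\alpha\in(0,1)$, with $z_{1-\alpha/2}$ the $(1-\alpha/2)$-quantile of the standard normal distribution, $$\lim_{k\to\infty}\Pr\Bigl(\hat\Delta_F-z_{1-\alpha/2}\operatorname{SE}(\hat\Delta_F)\le\Delta\le\hat\Delta_F+z_{1-\alpha/2}\operatorname{SE}(\hat\Delta_F)\Bigr)=1-\alpha .$$ -/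

import Mathlib

open MeasureTheory ProbabilityTheory Filter Topology

noncomputable section

/-- The data of a two-armed experiment with `T` batches (periods). `N t a` is the (random) number
of units that get arm `a` in period `t` (arm `1` is treatment, arm `0` is control), and `Y t a i`
is the outcome of the `i`-th unit of arm `a` in period `t`; it is observed when `i < N t a`. -/
structure BatchedData (T : ℕ) (Ω : Type*) [MeasurableSpace Ω] where
  N : Fin T → Fin 2 → Ω → ℕ
  Y : Fin T → Fin 2 → ℕ → Ω → ℝ
  measurable_N : ∀ t a, Measurable (N t a)
  measurable_Y : ∀ t a i, Measurable (Y t a i)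

namespace BatchedData

variable {T : ℕ} {Ω : Type*} [MeasurableSpace Ω] (E : BatchedData T Ω)

/-- The observed outcome: `Y t a i` if the arm has an `i`-th unit in period `t`, and `0` if not. -/
def observed (t : Fin T) (a : Fin 2) (i : ℕ) (ω : Ω) : ℝ :=
  if i < E.N t a ω then E.Y t a i ω else 0

/-- The information that is available when the outcomes of period `t` are drawn: the arm sizes of
the periods up to and including `t`, and the observed outcomes of the periods before `t`. -/
abbrev history (t : Fin T) : MeasurableSpace Ω :=
  (⨆ (s : Fin T) (_ : s ≤ t) (a : Fin 2), MeasurableSpace.comap (E.N s a) inferInstance) ⊔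
    (⨆ (s : Fin T) (_ : s < t) (a : Fin 2) (i : ℕ),
      MeasurableSpace.comap (E.observed s a i) inferInstance)

/-- The error `ε_{i,t}(a) = Y_{i,t}(a) - μ_{a,t}`. -/
def error (μ : Fin T → Fin 2 → ℝ) (t : Fin T) (a : Fin 2) (i : ℕ) (ω : Ω) : ℝ :=
  E.Y t a i ω - μ t a

/-- The sample mean of arm `a` in period `t`. -/
def armMean (t : Fin T) (a : Fin 2) (ω : Ω) : ℝ :=
  (∑ i ∈ Finset.range (E.N t a ω), E.Y t a i ω) / (E.N t a ω : ℝ)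

/-- The difference in sample means of period `t`. -/
def diffMeans (t : Fin T) (ω : Ω) : ℝ := E.armMean t 1 ω - E.armMean t 0 ω

/-- The plug-in variance `s t 1 / N_{1,t} + s t 0 / N_{0,t}` of the period difference, where
`s t a` is the true or the estimated variance of arm `a` in period `t`. -/
def periodVar (s : Fin T → Fin 2 → Ω → ℝ) (t : Fin T) (ω : Ω) : ℝ :=
  s t 1 ω / (E.N t 1 ω : ℝ) + s t 0 ω / (E.N t 0 ω : ℝ)

/-- The weight `w_t = 1 / √v_t`. -/
def weight (s : Fin T → Fin 2 → Ω → ℝ) (t : Fin T) (ω : Ω) : ℝ :=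
  1 / √(E.periodVar s t ω)

/-- The sum `S` of the weights. -/
def weightSum (s : Fin T → Fin 2 → Ω → ℝ) (ω : Ω) : ℝ := ∑ t, E.weight s t ω

/-- The weighted average effect estimate `∑ t, (w_t / S) * Δ̂_t`. -/
def weightedEstimator (s : Fin T → Fin 2 → Ω → ℝ) (ω : Ω) : ℝ :=
  ∑ t, E.weight s t ω / E.weightSum s ω * E.diffMeans t ω

/-- The standard error `√T / S` of the weighted estimate. -/
def stdError (s : Fin T → Fin 2 → Ω → ℝ) (ω : Ω) : ℝ := √(T : ℝ) / E.weightSum s ω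

/-- The interval with centre the weighted estimate and half-width `z` standard errors. -/
def confInterval (s : Fin T → Fin 2 → Ω → ℝ) (z : ℝ) (ω : Ω) : Set ℝ :=
  Set.Icc (E.weightedEstimator s ω - z * E.stdError s ω)
    (E.weightedEstimator s ω + z * E.stdError s ω)

/-- The sampling model of a batched adaptive experiment with mean outcomes `μ t a` and error laws
`ν t a`: in each period the errors of both arms are mutually independent, those of arm `a` have
the law `ν t a`, and all of them together are independent of the history, which includes the
current arm sizes. How the arm sizes depend on the past is not restricted. -/
structure IsAdaptive (P : Measure Ω) (μ : Fin T → Fin 2 → ℝ)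
    (ν : Fin T → Fin 2 → Measure ℝ) : Prop where
  law : ∀ t a i, P.map (E.error μ t a i) = ν t a
  indep : ∀ t, iIndepFun (fun p : Fin 2 × ℕ => E.error μ t p.1 p.2) P
  indep_history : ∀ t,
    Indep (⨆ (a : Fin 2) (i : ℕ), MeasurableSpace.comap (E.error μ t a i) inferInstance)
      (E.history t) P

end BatchedData

/-- `ν` is the law of a square-integrable random variable with mean `0` and variance `s`. -/
structure IsCenteredLaw (ν : Measure ℝ) (s : ℝ) : Prop where
  isProb : IsProbabilityMeasure ν
  memLp : MemLp id 2 ν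
  mean : ∫ x, x ∂ν = 0
  var : Var[id; ν] = s

/-- Convergence in probability to a constant, along random variables that may live on different
probability spaces. -/
def TendstoInProb {Ω : ℕ → Type*} [∀ k, MeasurableSpace (Ω k)] (P : ∀ k, Measure (Ω k))
    (X : ∀ k, Ω k → ℝ) (c : ℝ) : Prop :=
  ∀ δ : ℝ, 0 < δ → Tendsto (fun k => P k {ω | δ ≤ |X k ω - c|}) atTop (𝓝 0)

/-- Divergence to infinity in probability of natural-number-valued random variables. -/
def TendstoInfInProb {Ω : ℕ → Type*} [∀ k, MeasurableSpace (Ω k)] (P : ∀ k, Measure (Ω k))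
    (X : ∀ k, Ω k → ℕ) : Prop :=
  ∀ M : ℕ, Tendsto (fun k => P k {ω | X k ω ≤ M}) atTop (𝓝 0)

/-- The `p`-quantile of the standard normal distribution. -/
def stdNormalQuantile (p : ℝ) : ℝ := sInf {x : ℝ | p ≤ cdf (gaussianReal 0 1) x}

end

/-! As soon as all arms are non-empty and all variance estimates positive, the sum `Ŝ` cancels, and
`(Δ̂_F - Δ) / SE` equals `T^{-1/2} ∑ ŵ_t (ε̄_{1,t} - ε̄_{0,t})`. The weights `1/√v_t` thus
standardize each period separately, which is why the allocation may adapt freely: no limit of the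
arm sizes or of their ratio is needed.

With the true variances, call the period terms `Z_t` (`stdDiff`). Given the history of period `t`,
the arm sizes are fixed and `Z_t` is a standardized difference of independent sample means. Its
conditional characteristic function depends on the sizes alone, and it is close to `exp(-u²/2)` once
both sizes are large, whatever their ratio (`norm_diffCharFun_sub_le`); the error laws do not vary
with `k`, so one threshold serves the whole sequence. The earlier `Z_s` are functions of the history
(`integral_mul_comp_of_indep`), so each period contributes an asymptotic factor `exp(-u²/2)`.
Induction over periods (`tendsto_integral_exp_sum_stdDiff`) gives a standard normal limit for
`T^{-1/2} ∑ Z_t`.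

Estimating the variances changes each weight by a small relative error. Since `Z_t` is tight, the
resulting change vanishes in probability. Lévy's continuity theorem and the absence of atoms then
give the coverage. -/

/-! ### Characteristic functions of centered laws -/

/-- Second-order expansion at `0` of the characteristic function of a centered law. -/
lemma IsCenteredLaw.charFun_sub_isLittleO {ν : Measure ℝ} {s : ℝ} (h : IsCenteredLaw ν s) :
    (fun x : ℝ => charFun ν x - (1 - s * x ^ 2 / 2)) =o[𝓝 0] fun x : ℝ => x ^ 2 := by
  have := h.isProb
  have h2 : ∫ x, x ^ 2 ∂ν = s := by
    have := variance_eq_integral (μ := ν) (X := id) aemeasurable_id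
    rw [h.var] at this
    simpa [h.mean] using this.symm
  have key : ∀ x : ℝ, taylorWithinEval (charFun ν) 2 Set.univ 0 x = 1 - s * x ^ 2 / 2 := by
    intro x
    have := taylorWithinEval_charFun_two_zero (P := ν) (X := id) aemeasurable_id
      (by simpa using h.memLp) x
    rw [Measure.map_id] at this
    rw [this]
    simp [h.mean, h2]
  simp_rw [← key]
  have hc : ContDiff ℝ (2 : ℕ) (charFun ν) := contDiff_charFun (by simpa using h.memLp)
  simpa using taylor_isLittleO_univ (x₀ := (0 : ℝ)) hc

lemma isCenteredLaw_gaussianReal {s : ℝ} (hs : 0 ≤ s) :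
    IsCenteredLaw (gaussianReal 0 s.toNNReal) s where
  isProb := inferInstance
  memLp := memLp_id_gaussianReal 2
  mean := by simp
  var := by simp [hs]

lemma charFun_gaussianReal_pow (v : NNReal) (x : ℝ) (n : ℕ) :
    charFun (gaussianReal 0 v) x ^ n = Complex.exp (-((v : ℝ) * (n * x ^ 2) / 2 : ℝ)) := by
  rw [charFun_gaussianReal, ← Complex.exp_nat_mul]
  congr 1
  push_cast
  ring

/-- Lindeberg's replacement argument: the factors are exchanged one at a time, each at cost `‖z -
w‖`. -/
lemma norm_pow_sub_pow_le_mul {z w : ℂ} (hz : ‖z‖ ≤ 1) (hw : ‖w‖ ≤ 1) (n : ℕ) :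
    ‖z ^ n - w ^ n‖ ≤ n * ‖z - w‖ := by
  induction n with
  | zero => simp
  | succ n ih =>
    have : z ^ (n + 1) - w ^ (n + 1) = z ^ n * (z - w) + (z ^ n - w ^ n) * w := by ring
    rw [this]
    refine (norm_add_le _ _).trans ?_
    rw [norm_mul, norm_mul, norm_pow]
    have h1 : ‖z‖ ^ n * ‖z - w‖ ≤ 1 * ‖z - w‖ := by
      gcongr
      exact pow_le_one₀ (norm_nonneg _) hz
    have h2 : ‖z ^ n - w ^ n‖ * ‖w‖ ≤ (n * ‖z - w‖) * 1 := by gcongr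
    push_cast
    linarith

/-- Powers of the characteristic function of a centered law are uniformly close to powers of the
Gaussian one, as long as the argument is of the order of the inverse square root of the exponent. -/
lemma IsCenteredLaw.norm_charFun_pow_sub_le {ν : Measure ℝ} {s : ℝ} (h : IsCenteredLaw ν s)
    (hs : 0 < s) (C : ℝ) {ε : ℝ} (hε : 0 < ε) :
    ∃ M : ℕ, ∀ n : ℕ, M < n → ∀ x : ℝ, n * x ^ 2 ≤ C →
      ‖charFun ν x ^ n - Complex.exp (-(s * (n * x ^ 2) / 2 : ℝ))‖ ≤ ε := by
  have := h.isProb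
  have hlit := h.charFun_sub_isLittleO.sub
    (isCenteredLaw_gaussianReal hs.le).charFun_sub_isLittleO
  -- Both laws share the quadratic polynomial, so the two characteristic functions differ by
  -- `o(x²)`.
  simp only [sub_sub_sub_cancel_right] at hlit
  have hC : 0 < |C| + 1 := by positivity
  have hev := hlit.def (c := ε / (|C| + 1)) (by positivity)
  obtain ⟨r, hr, hball⟩ := Metric.eventually_nhds_iff.1 hev
  -- For `n > M`, the bound `n * x ^ 2 ≤ |C| + 1` forces `|x| < r`; the `+ 1` keeps the divisor
  -- positive for every `C`.
  obtain ⟨M, hM⟩ := exists_nat_gt ((|C| + 1) / r ^ 2)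
  refine ⟨M, fun n hn x hx => ?_⟩
  have hn0 : (0 : ℝ) < n := by exact_mod_cast (Nat.zero_le M).trans_lt hn
  have hnM : (M : ℝ) < n := by exact_mod_cast hn
  have hxC : n * x ^ 2 ≤ |C| + 1 := by linarith [le_abs_self C]
  have hxr : |x| < r := by
    refine abs_lt_of_sq_lt_sq ?_ hr.le
    have h1 : |C| + 1 < n * r ^ 2 := by
      rw [div_lt_iff₀ (by positivity)] at hM
      nlinarith [sq_nonneg r, pow_pos hr 2]
    by_contra! hcon
    nlinarith
  have hb := hball (y := x) (by simpa using hxr)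
  have hsn : ((s.toNNReal : NNReal) : ℝ) = s := Real.coe_toNNReal _ hs.le
  have hg := charFun_gaussianReal_pow s.toNNReal x n
  rw [hsn] at hg
  rw [← hg]
  refine (norm_pow_sub_pow_le_mul (norm_charFun_le_one _) (norm_charFun_le_one _) n).trans ?_
  rw [Real.norm_of_nonneg (sq_nonneg x)] at hb
  calc (n : ℝ) * ‖charFun ν x - charFun (gaussianReal 0 s.toNNReal) x‖
      ≤ n * (ε / (|C| + 1) * x ^ 2) := by gcongr
    _ = ε / (|C| + 1) * (n * x ^ 2) := by ring
    _ ≤ ε / (|C| + 1) * (|C| + 1) := by gcongr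
    _ = ε := by field_simp

/-! ### Differences of two sample means with fixed sizes -/

/-- The weight of a period with the arm sizes `n.1` and `n.2` and the arm variances `s₁`, `s₀`. -/
noncomputable def sizeWeight (s₁ s₀ : ℝ) (n : ℕ × ℕ) : ℝ := 1 / √(s₁ / n.1 + s₀ / n.2)

/-- The characteristic function at `u` of the standardized difference of two sample means with the
sizes `n.1` and `n.2`, for independent samples from `ν₁` and `ν₀`. -/
noncomputable def diffCharFun (ν₁ ν₀ : Measure ℝ) (s₁ s₀ u : ℝ) (n : ℕ × ℕ) : ℂ :=
  charFun ν₁ (u * (sizeWeight s₁ s₀ n / n.1)) ^ n.1 *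
    charFun ν₀ (u * -(sizeWeight s₁ s₀ n / n.2)) ^ n.2

lemma norm_diffCharFun_le_one (ν₁ ν₀ : Measure ℝ) [IsProbabilityMeasure ν₁]
    [IsProbabilityMeasure ν₀] (s₁ s₀ u : ℝ) (n : ℕ × ℕ) :
    ‖diffCharFun ν₁ ν₀ s₁ s₀ u n‖ ≤ 1 := by
  rw [diffCharFun, norm_mul, norm_pow, norm_pow]
  exact mul_le_one₀ (pow_le_one₀ (norm_nonneg _) (norm_charFun_le_one _)) (by positivity)
    (pow_le_one₀ (norm_nonneg _) (norm_charFun_le_one _))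

lemma sizeWeight_sq {s₁ s₀ : ℝ} (h₁ : 0 < s₁) (h₀ : 0 < s₀) (n : ℕ × ℕ) :
    sizeWeight s₁ s₀ n ^ 2 = 1 / (s₁ / n.1 + s₀ / n.2) := by
  rw [sizeWeight, div_pow, one_pow, Real.sq_sqrt (by positivity)]

/-- Central limit theorem for a difference of two sample means, in terms of characteristic
functions and without a restriction on the ratio of the sample sizes. -/
lemma norm_diffCharFun_sub_le {ν₁ ν₀ : Measure ℝ} {s₁ s₀ : ℝ} (hν₁ : IsCenteredLaw ν₁ s₁)
    (hν₀ : IsCenteredLaw ν₀ s₀) (h₁ : 0 < s₁) (h₀ : 0 < s₀) (u : ℝ) {ε : ℝ} (hε : 0 < ε) :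
    ∃ M : ℕ, ∀ n : ℕ × ℕ, M < n.1 → M < n.2 →
      ‖diffCharFun ν₁ ν₀ s₁ s₀ u n - Complex.exp (-(u ^ 2 / 2 : ℝ))‖ ≤ ε := by
  obtain ⟨M₁, hM₁⟩ := hν₁.norm_charFun_pow_sub_le h₁ (u ^ 2 / s₁) (half_pos hε)
  obtain ⟨M₀, hM₀⟩ := hν₀.norm_charFun_pow_sub_le h₀ (u ^ 2 / s₀) (half_pos hε)
  have := hν₁.isProb
  have := hν₀.isProb
  refine ⟨max M₁ M₀, fun n hn₁ hn₀ => ?_⟩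
  have p₁ : (0 : ℝ) < n.1 := by exact_mod_cast (Nat.zero_le _).trans_lt hn₁
  have p₀ : (0 : ℝ) < n.2 := by exact_mod_cast (Nat.zero_le _).trans_lt hn₀
  -- The quantities in `e₁` and `e₀`, multiplied by `s₁` and `s₀`, add up to `u ^ 2`. Hence each is
  -- bounded by `u ^ 2 / s₁` or `u ^ 2 / s₀` irrespective of the ratio of sizes, and the two
  -- Gaussian factors multiply to `exp(-u²/2)`.
  have e₁ : n.1 * (u * (sizeWeight s₁ s₀ n / n.1)) ^ 2 = u ^ 2 * n.2 / (s₁ * n.2 + s₀ * n.1) := by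
    rw [mul_pow, div_pow, sizeWeight_sq h₁ h₀]
    field_simp
  have e₀ : n.2 * (u * -(sizeWeight s₁ s₀ n / n.2)) ^ 2
      = u ^ 2 * n.1 / (s₁ * n.2 + s₀ * n.1) := by
    rw [mul_pow, neg_sq, div_pow, sizeWeight_sq h₁ h₀]
    field_simp
  have b₁ := hM₁ n.1 ((le_max_left _ _).trans_lt hn₁) (u * (sizeWeight s₁ s₀ n / n.1)) (by
    rw [e₁, div_le_div_iff₀ (by positivity) h₁]
    nlinarith [mul_nonneg (sq_nonneg u) (mul_pos h₀ p₁).le])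
  have b₀ := hM₀ n.2 ((le_max_right _ _).trans_lt hn₀) (u * -(sizeWeight s₁ s₀ n / n.2)) (by
    rw [e₀, div_le_div_iff₀ (by positivity) h₀]
    nlinarith [mul_nonneg (sq_nonneg u) (mul_pos h₁ p₀).le])
  rw [e₁] at b₁
  rw [e₀] at b₀
  have hexp : Complex.exp (-(u ^ 2 / 2 : ℝ)) =
      Complex.exp (-(s₁ * (u ^ 2 * n.2 / (s₁ * n.2 + s₀ * n.1)) / 2 : ℝ)) *
        Complex.exp (-(s₀ * (u ^ 2 * n.1 / (s₁ * n.2 + s₀ * n.1)) / 2 : ℝ)) := by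
    rw [← Complex.exp_add, ← neg_add, ← Complex.ofReal_add]
    congr 3
    field_simp
  have hnorm : ‖Complex.exp (-(s₁ * (u ^ 2 * n.2 / (s₁ * n.2 + s₀ * n.1)) / 2 : ℝ))‖ ≤ 1 := by
    rw [← Complex.ofReal_neg, ← Complex.ofReal_exp, Complex.norm_real, Real.norm_of_nonneg
      (Real.exp_nonneg _), Real.exp_le_one_iff, neg_nonpos]
    positivity
  rw [hexp, diffCharFun]
  generalize charFun ν₁ (u * (sizeWeight s₁ s₀ n / n.1)) ^ n.1 = a at b₁ ⊢
  generalize hb : charFun ν₀ (u * -(sizeWeight s₁ s₀ n / n.2)) ^ n.2 = b at b₀ ⊢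
  have hb1 : ‖b‖ ≤ 1 := by
    rw [← hb, norm_pow]
    exact pow_le_one₀ (norm_nonneg _) (norm_charFun_le_one _)
  generalize Complex.exp (-(s₁ * (u ^ 2 * n.2 / (s₁ * n.2 + s₀ * n.1)) / 2 : ℝ)) = c at *
  generalize Complex.exp (-(s₀ * (u ^ 2 * n.1 / (s₁ * n.2 + s₀ * n.1)) / 2 : ℝ)) = d at *
  have : a * b - c * d = (a - c) * b + c * (b - d) := by ring
  rw [this]
  refine (norm_add_le _ _).trans ?_
  rw [norm_mul, norm_mul]
  have i1 : ‖a - c‖ * ‖b‖ ≤ ε / 2 * 1 := by gcongr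
  have i2 : ‖c‖ * ‖b - d‖ ≤ 1 * (ε / 2) := by gcongr
  linarith

/-! ### Conditioning on random sample sizes -/

/-- If `G n` is independent of `A` and of the discrete variable `N`, then `G N` may be replaced
under the expectation by its conditional mean given `N`. -/
lemma integral_mul_comp_of_indep {Ω β : Type*} {m₁ m₂ : MeasurableSpace Ω}
    [mΩ : MeasurableSpace Ω] {P : Measure Ω} [IsProbabilityMeasure P]
    [Countable β] [MeasurableSpace β] [MeasurableSingletonClass β]
    (hm₁ : m₁ ≤ mΩ) (hm₂ : m₂ ≤ mΩ) (hind : Indep m₁ m₂ P)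
    {A : Ω → ℂ} (hA : Measurable[m₂] A) (hA1 : ∀ ω, ‖A ω‖ ≤ 1)
    {N : Ω → β} (hN : Measurable[m₂] N)
    {G : β → Ω → ℂ} (hG : ∀ n, Measurable[m₁] (G n)) (hG1 : ∀ n ω, ‖G n ω‖ ≤ 1) :
    ∫ ω, A ω * G (N ω) ω ∂P = ∫ ω, A ω * ∫ ω', G (N ω) ω' ∂P ∂P := by
  have hNm : Measurable N := hN.mono hm₂ le_rfl
  have hAm : Measurable A := hA.mono hm₂ le_rfl
  have hGm : ∀ n, Measurable (G n) := fun n => (hG n).mono hm₁ le_rfl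
  have hmeas : ∀ F : β → Ω → ℂ, (∀ n, Measurable (F n)) → Measurable fun ω => F (N ω) ω :=
    fun F hF => (measurable_from_prod_countable_left (f := fun p : Ω × β => F p.2 p.1) hF).comp
      (measurable_id.prodMk hNm)
  have hint : ∀ F : β → Ω → ℂ, (∀ n, Measurable (F n)) → (∀ n ω, ‖F n ω‖ ≤ 1) →
      Integrable (fun ω => A ω * F (N ω) ω) P := by
    intro F hF hF1
    refine Integrable.of_bound (hAm.mul (hmeas F hF)).aestronglyMeasurable 1 (ae_of_all _ ?_)
    intro ω
    rw [norm_mul]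
    exact mul_le_one₀ (hA1 ω) (norm_nonneg _) (hF1 _ _)
  have hsplit : ∀ f : Ω → ℂ, Integrable f P →
      ∫ ω, f ω ∂P = ∑' n, ∫ ω in N ⁻¹' {n}, f ω ∂P := by
    intro f hf
    rw [← integral_iUnion (fun n => hNm (measurableSet_singleton n))
      (fun i j hij => Disjoint.preimage _ (by simpa using hij)) hf.integrableOn]
    rw [← Set.preimage_iUnion, Set.iUnion_of_singleton, Set.preimage_univ, Measure.restrict_univ]
  have hG1' : ∀ n, ‖∫ ω', G n ω' ∂P‖ ≤ 1 := fun n => by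
    simpa using norm_integral_le_of_norm_le_const (μ := P) (ae_of_all _ (hG1 n))
  rw [hsplit _ (hint G hGm hG1),
    hsplit _ (hint (fun n _ => ∫ ω', G n ω' ∂P) (fun _ => measurable_const) fun n _ => hG1' n)]
  congr 1
  ext n
  have hset : MeasurableSet (N ⁻¹' {n}) := hNm (measurableSet_singleton n)
  have hset₂ : MeasurableSet[m₂] (N ⁻¹' {n}) := hN (measurableSet_singleton n)
  -- On `{N = n}` the random index is frozen, and the indicator of this event is absorbed into the
  -- `m₂`-measurable factor.
  have hI : Measurable[m₂] ((N ⁻¹' {n}).indicator A) := hA.indicator hset₂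
  have hIndep : IndepFun ((N ⁻¹' {n}).indicator A) (G n) P := by
    rw [IndepFun_iff_Indep]
    exact indep_of_indep_of_le_left (indep_of_indep_of_le_right hind.symm (hG n).comap_le)
      hI.comap_le
  have l1 : ∫ ω in N ⁻¹' {n}, A ω * G (N ω) ω ∂P
      = ∫ ω, (N ⁻¹' {n}).indicator A ω * G n ω ∂P := by
    rw [← integral_indicator hset]
    congr 1
    ext ω
    by_cases h : ω ∈ N ⁻¹' {n}
    · have h' : N ω = n := h
      simp [h']
    · simp [Set.indicator_of_notMem h]
  have l2 : ∫ ω in N ⁻¹' {n}, A ω * ∫ ω', G (N ω) ω' ∂P ∂P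
      = ∫ ω, (N ⁻¹' {n}).indicator A ω * (∫ ω', G n ω' ∂P) ∂P := by
    rw [← integral_indicator hset]
    congr 1
    ext ω
    by_cases h : ω ∈ N ⁻¹' {n}
    · have h' : N ω = n := h
      simp [h']
    · simp [Set.indicator_of_notMem h]
  rw [l1, l2, hIndep.integral_fun_mul_eq_mul_integral
    (hI.mono hm₂ le_rfl).aestronglyMeasurable (hGm n).aestronglyMeasurable, integral_mul_const]

/-- The characteristic function of a standardized difference of two sample means. -/
lemma charFun_map_diffMeans {Ω : Type*} [MeasurableSpace Ω] {P : Measure Ω}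
    [IsProbabilityMeasure P] {ε : Fin 2 → ℕ → Ω → ℝ} (hm : ∀ a i, Measurable (ε a i))
    {ν : Fin 2 → Measure ℝ} (hlaw : ∀ a i, P.map (ε a i) = ν a)
    (hind : iIndepFun (fun p : Fin 2 × ℕ => ε p.1 p.2) P) (s₁ s₀ u : ℝ) (n : ℕ × ℕ) :
    charFun (P.map fun ω => sizeWeight s₁ s₀ n *
      ((∑ i ∈ Finset.range n.1, ε 1 i ω) / n.1 - (∑ i ∈ Finset.range n.2, ε 0 i ω) / n.2)) u =
    diffCharFun (ν 1) (ν 0) s₁ s₀ u n := by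
  set w := sizeWeight s₁ s₀ n with hw
  -- Signed coefficients turn the difference of means into one weighted sum of independent errors
  -- indexed by pairs.
  let c : Fin 2 → ℝ := fun a => if a = 1 then w / n.1 else -(w / n.2)
  have hdisj : Disjoint (({1} : Finset (Fin 2)) ×ˢ Finset.range n.1)
      (({0} : Finset (Fin 2)) ×ˢ Finset.range n.2) := by
    rw [Finset.disjoint_left]
    rintro ⟨a, i⟩ h1 h2
    simp only [Finset.mem_product, Finset.mem_singleton] at h1 h2
    exact absurd (h1.1.symm.trans h2.1) (by decide)
  have hrw : (fun ω => w * ((∑ i ∈ Finset.range n.1, ε 1 i ω) / n.1 -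
      (∑ i ∈ Finset.range n.2, ε 0 i ω) / n.2)) = fun ω =>
      ∑ p ∈ (({1} : Finset (Fin 2)) ×ˢ Finset.range n.1) ∪
        (({0} : Finset (Fin 2)) ×ˢ Finset.range n.2), c p.1 * ε p.1 p.2 ω := by
    ext ω
    rw [Finset.sum_union hdisj, Finset.sum_product, Finset.sum_product]
    simp only [Finset.sum_singleton, ← Finset.mul_sum, c]
    simp
    ring
  have hind' : iIndepFun (fun (p : Fin 2 × ℕ) ω => c p.1 * ε p.1 p.2 ω) P :=
    hind.comp (fun p x => c p.1 * x) fun p => by fun_prop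
  rw [hrw, (hind'.restrict _).charFun_map_fun_finsetSum_eq_prod
    (fun p _ => ((hm p.1 p.2).const_mul _).aemeasurable), Finset.prod_apply]
  simp_rw [charFun_map_mul_comp (hm _ _).aemeasurable, hlaw]
  rw [Finset.prod_union hdisj, Finset.prod_product, Finset.prod_product]
  simp [c, diffCharFun, ← hw, mul_comm]

lemma measurable_sum_range_comp {Ω : Type*} [MeasurableSpace Ω] {N : Ω → ℕ} (hN : Measurable N)
    {X : ℕ → Ω → ℝ} (hX : ∀ i, Measurable (X i)) :
    Measurable fun ω => ∑ i ∈ Finset.range (N ω), X i ω :=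
  (measurable_from_prod_countable_left
    (f := fun p : Ω × ℕ => ∑ i ∈ Finset.range p.2, X i p.1)
    fun n => Finset.measurable_fun_sum (Finset.range n) fun i _ => hX i).comp (measurable_id.prodMk hN)

/-! ### Errors, history and measurability -/

namespace BatchedData

variable {T : ℕ} {Ω : Type*} {m : MeasurableSpace Ω} [mΩ : MeasurableSpace Ω] (E : BatchedData T Ω)

/-- The sample mean of the errors of arm `a` in period `t`. -/
noncomputable def errMean (μ : Fin T → Fin 2 → ℝ) (t : Fin T) (a : Fin 2) (ω : Ω) : ℝ :=
  (∑ i ∈ Finset.range (E.N t a ω), E.error μ t a i ω) / (E.N t a ω : ℝ)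

/-- The standardized estimation error of period `t`, with the true variances. -/
noncomputable def stdDiff (μ σsq : Fin T → Fin 2 → ℝ) (t : Fin T) (ω : Ω) : ℝ :=
  E.weight (fun t a _ => σsq t a) t ω * (E.errMean μ t 1 ω - E.errMean μ t 0 ω)

variable (μ σsq : Fin T → Fin 2 → ℝ)

/-- The information in the errors of period `t`. -/
@[reducible] def errorAlgebra (t : Fin T) : MeasurableSpace Ω :=
  ⨆ (a : Fin 2) (i : ℕ), MeasurableSpace.comap (E.error μ t a i) inferInstance

lemma measurable_error (t : Fin T) (a : Fin 2) (i : ℕ) : Measurable (E.error μ t a i) :=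
  (E.measurable_Y t a i).sub_const _

lemma measurable_natCast_N {t : Fin T} {a : Fin 2}
    (h : Measurable[m] (E.N t a)) : Measurable[m] fun ω => (E.N t a ω : ℝ) :=
  measurable_from_top.comp h

/-- Only units below the arm size enter the mean, so past error means are functions of observed
data. The history does not contain the unobserved outcomes. -/
lemma errMean_eq_observed (t : Fin T) (a : Fin 2) :
    E.errMean μ t a = fun ω =>
      (∑ i ∈ Finset.range (E.N t a ω), (E.observed t a i ω - μ t a)) / (E.N t a ω : ℝ) := by
  ext ω
  rw [errMean]
  congr 1
  refine Finset.sum_congr rfl fun i hi => ?_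
  rw [error, observed, if_pos (Finset.mem_range.1 hi)]

lemma measurable_errMean {t : Fin T} {a : Fin 2}
    (hN : Measurable[m] (E.N t a)) (hY : ∀ i, Measurable[m] (E.observed t a i)) :
    Measurable[m] (E.errMean μ t a) := by
  rw [errMean_eq_observed]
  exact (@measurable_sum_range_comp Ω m _ hN (fun i ω => E.observed t a i ω - μ t a)
    fun i => (hY i).sub_const _).div (E.measurable_natCast_N hN)

lemma measurable_weight {s : Fin T → Fin 2 → Ω → ℝ} {t : Fin T}
    (hs : ∀ a, Measurable[m] (s t a)) (hN : ∀ a, Measurable[m] (E.N t a)) :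
    Measurable[m] (E.weight s t) := by
  have := E.measurable_natCast_N (hN 0)
  have := E.measurable_natCast_N (hN 1)
  have := hs 0
  have := hs 1
  unfold weight periodVar
  fun_prop

lemma measurable_stdDiff {t : Fin T} (hN : ∀ a, Measurable[m] (E.N t a))
    (hY : ∀ a i, Measurable[m] (E.observed t a i)) : Measurable[m] (E.stdDiff μ σsq t) :=
  (E.measurable_weight (fun _ => measurable_const) hN).mul
    ((E.measurable_errMean μ (hN 1) (hY 1)).sub (E.measurable_errMean μ (hN 0) (hY 0)))

lemma measurable_observed (t : Fin T) (a : Fin 2) (i : ℕ) : Measurable (E.observed t a i) :=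
  Measurable.ite ((E.measurable_N t a) measurableSet_Ioi) (E.measurable_Y t a i) measurable_const

lemma measurable_N_history {s t : Fin T} (hst : s ≤ t) (a : Fin 2) :
    Measurable[E.history t] (E.N s a) := by
  rw [measurable_iff_comap_le]
  exact le_sup_of_le_left (le_iSup₂_of_le s hst (le_iSup_of_le a le_rfl))

lemma measurable_observed_history {s t : Fin T} (hst : s < t) (a : Fin 2) (i : ℕ) :
    Measurable[E.history t] (E.observed s a i) := by
  rw [measurable_iff_comap_le]
  exact le_sup_of_le_right
    (le_iSup₂_of_le s hst (le_iSup_of_le a (le_iSup_of_le i le_rfl)))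

lemma history_le (t : Fin T) : E.history t ≤ mΩ := by
  refine sup_le ?_ ?_
  · exact iSup₂_le fun s _ => iSup_le fun a => (E.measurable_N s a).comap_le
  · exact iSup₂_le fun s _ => iSup₂_le fun a i => (E.measurable_observed s a i).comap_le

variable {E μ σsq} {P : Measure Ω} [IsProbabilityMeasure P] {ν : Fin T → Fin 2 → Measure ℝ}

/-- Given the history, the standardized estimation error of a period is a standardized difference
of two sample means with fixed sizes. -/
lemma IsAdaptive.integral_mul_exp_stdDiff (hE : E.IsAdaptive P μ ν) (t : Fin T) (u : ℝ)
    {A : Ω → ℂ} (hA : Measurable[E.history t] A) (hA1 : ∀ ω, ‖A ω‖ ≤ 1) :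
    ∫ ω, A ω * Complex.exp (u * E.stdDiff μ σsq t ω * Complex.I) ∂P =
      ∫ ω, A ω * diffCharFun (ν t 1) (ν t 0) (σsq t 1) (σsq t 0) u (E.N t 1 ω, E.N t 0 ω) ∂P := by
  -- `F n` is the standardized error with the sizes frozen at `n`; evaluating it at the actual sizes
  -- gives `stdDiff` by definition.
  let F : ℕ × ℕ → Ω → ℝ := fun n ω => sizeWeight (σsq t 1) (σsq t 0) n *
    ((∑ i ∈ Finset.range n.1, E.error μ t 1 i ω) / n.1 -
      (∑ i ∈ Finset.range n.2, E.error μ t 0 i ω) / n.2)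
  have herr : ∀ a i, Measurable[E.errorAlgebra μ t] (E.error μ t a i) := fun a i => by
    rw [measurable_iff_comap_le]
    exact le_iSup₂_of_le a i le_rfl
  have hle : E.errorAlgebra μ t ≤ mΩ :=
    iSup₂_le fun a i => (E.measurable_error μ t a i).comap_le
  have hF : ∀ n, Measurable[E.errorAlgebra μ t] (F n) := fun n =>
    (((Finset.measurable_fun_sum _ fun i _ => herr 1 i).div_const _).sub
      ((Finset.measurable_fun_sum _ fun i _ => herr 0 i).div_const _)).const_mul _
  have hG : ∀ n, Measurable[E.errorAlgebra μ t] fun ω => Complex.exp (u * F n ω * Complex.I) := fun n =>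
    (show Measurable fun x : ℝ => Complex.exp (u * x * Complex.I) by fun_prop).comp (hF n)
  have hN : Measurable[E.history t] fun ω => (E.N t 1 ω, E.N t 0 ω) :=
    (E.measurable_N_history le_rfl 1).prodMk (E.measurable_N_history le_rfl 0)
  have key := integral_mul_comp_of_indep hle (E.history_le t) (hE.indep_history t) hA hA1 hN hG
    (fun n ω => by rw [← Complex.ofReal_mul, Complex.norm_exp_ofReal_mul_I])
  have hval : ∀ n, ∫ ω, Complex.exp (u * F n ω * Complex.I) ∂P =
      diffCharFun (ν t 1) (ν t 0) (σsq t 1) (σsq t 0) u n := by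
    intro n
    rw [← charFun_map_diffMeans (P := P) (E.measurable_error μ t) (hE.law t) (hE.indep t),
      charFun_apply_real, integral_map ((hF n).mono hle le_rfl).aemeasurable (by fun_prop)]
  simp_rw [hval] at key
  exact key

end BatchedData

/-! ### The standard normal quantile -/

section GaussianQuantile

lemma continuous_cdf (ρ : Measure ℝ) [IsProbabilityMeasure ρ] [NullSingletonClass ρ] :
    Continuous (cdf ρ) := by
  rw [continuous_iff_continuousAt]
  intro x
  rw [(monotone_cdf ρ).continuousAt_iff_leftLim_eq_rightLim, (cdf ρ).rightLim_eq]
  refine le_antisymm ((monotone_cdf ρ).leftLim_le le_rfl) ?_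
  have h := (cdf ρ).measure_singleton x
  rw [measure_cdf, measure_singleton] at h
  linarith [ENNReal.ofReal_eq_zero.1 h.symm]

lemma cdf_stdNormalQuantile {p : ℝ} (hp : p ∈ Set.Ioo (0 : ℝ) 1) :
    cdf (gaussianReal 0 1) (stdNormalQuantile p) = p := by
  have : NullSingletonClass (gaussianReal 0 1) := nullSingletonClass_gaussianReal one_ne_zero
  have hc := continuous_cdf (gaussianReal 0 1)
  have hne : {x : ℝ | p ≤ cdf (gaussianReal 0 1) x}.Nonempty :=
    ((tendsto_cdf_atTop (gaussianReal 0 1)).eventually (eventually_ge_nhds hp.2)).exists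
  obtain ⟨b, hb⟩ :=
    ((tendsto_cdf_atBot (gaussianReal 0 1)).eventually (eventually_lt_nhds hp.1)).exists
  have hbdd : BddBelow {x : ℝ | p ≤ cdf (gaussianReal 0 1) x} := by
    refine ⟨b, fun x hx => ?_⟩
    by_contra! hxb
    exact absurd (hx.trans (monotone_cdf _ hxb.le)) (not_le.2 hb)
  -- Closedness puts the infimum in the set, which gives one inequality. For the other, the cdf is
  -- below `p` to the left of the infimum, and continuity passes this to the limit.
  refine le_antisymm ?_ ((isClosed_le continuous_const hc).csInf_mem hne hbdd)
  refine le_of_tendsto (hc.continuousWithinAt (s := Set.Iio (stdNormalQuantile p)))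
    (eventually_nhdsWithin_of_forall fun x hx => ?_)
  by_contra! hcon
  exact absurd (csInf_le hbdd hcon.le) (not_le.2 hx)

lemma gaussianReal_Icc_stdNormalQuantile {α : ℝ} (hα : α ∈ Set.Ioo (0 : ℝ) 1) :
    (gaussianReal 0 1).real
      (Set.Icc (-stdNormalQuantile (1 - α / 2)) (stdNormalQuantile (1 - α / 2))) = 1 - α := by
  have : NullSingletonClass (gaussianReal 0 1) := nullSingletonClass_gaussianReal one_ne_zero
  have hz := cdf_stdNormalQuantile (p := 1 - α / 2) ⟨by linarith [hα.2], by linarith [hα.1]⟩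
  set z := stdNormalQuantile (1 - α / 2)
  rw [cdf_eq_real] at hz
  have hIio : (gaussianReal 0 1).real (Set.Iio (-z)) = α / 2 := by
    have hneg : (gaussianReal 0 1).real (Set.Iio (-z)) = (gaussianReal 0 1).real (Set.Ioi z) := by
      have hmap : (gaussianReal 0 1).map (fun x => -x) = gaussianReal 0 1 := by
        simpa using gaussianReal_map_neg (μ := 0) (v := 1)
      conv_lhs => rw [← hmap]
      rw [map_measureReal_apply measurable_neg measurableSet_Iio]
      congr 1
      ext x
      simp
    rw [hneg, ← Set.compl_Iic, probReal_compl_eq_one_sub measurableSet_Iic, hz]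
    ring
  -- Otherwise `Iic z ⊆ Iio (-z)` would give `1 - α / 2 ≤ α / 2`, against `α < 1`.
  have hlt : -z ≤ z := by
    by_contra! hcon
    have := measureReal_mono (μ := gaussianReal 0 1)
      (show Set.Iic z ⊆ Set.Iio (-z) from fun x hx => lt_of_le_of_lt hx hcon)
    linarith [hα.2]
  have hunion : Set.Iio (-z) ∪ Set.Icc (-z) z = Set.Iic z := Set.Iio_union_Icc_eq_Iic hlt
  have := measureReal_union (μ := gaussianReal 0 1) (s₁ := Set.Iio (-z)) (s₂ := Set.Icc (-z) z)
    (Set.disjoint_left.2 fun x hx hx' => not_le.2 hx hx'.1) measurableSet_Icc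
  rw [hunion] at this
  linarith

end GaussianQuantile

/-! ### Convergence in probability on varying probability spaces -/

section Sequences

variable {Ω : ℕ → Type*} [∀ k, MeasurableSpace (Ω k)] {P : ∀ k, Measure (Ω k)}

lemma tendsto_measure_union {A B : ∀ k, Set (Ω k)}
    (hA : Tendsto (fun k => P k (A k)) atTop (𝓝 0))
    (hB : Tendsto (fun k => P k (B k)) atTop (𝓝 0)) :
    Tendsto (fun k => P k (A k ∪ B k)) atTop (𝓝 0) :=
  tendsto_of_tendsto_of_tendsto_of_le_of_le tendsto_const_nhds (by simpa using hA.add hB)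
    (fun _ => zero_le) fun _ => measure_union_le _ _

lemma tendsto_measure_iUnion {ι : Type*} [Fintype ι] {A : ι → ∀ k, Set (Ω k)}
    (hA : ∀ i, Tendsto (fun k => P k (A i k)) atTop (𝓝 0)) :
    Tendsto (fun k => P k (⋃ i, A i k)) atTop (𝓝 0) :=
  tendsto_of_tendsto_of_tendsto_of_le_of_le tendsto_const_nhds
    (by simpa using tendsto_finsetSum Finset.univ fun i _ => hA i)
    (fun _ => zero_le) fun k => measure_iUnion_fintype_le (P k) fun i => A i k

lemma tendsto_measureReal_zero {A : ∀ k, Set (Ω k)}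
    (hA : Tendsto (fun k => P k (A k)) atTop (𝓝 0)) :
    Tendsto (fun k => (P k).real (A k)) atTop (𝓝 0) := by
  simpa [Measure.real, Function.comp_def] using (ENNReal.tendsto_toReal ENNReal.zero_ne_top).comp hA

variable [∀ k, IsProbabilityMeasure (P k)]

lemma norm_exp_ofReal_mul_I_sub_le (x y : ℝ) :
    ‖Complex.exp (x * Complex.I) - Complex.exp (y * Complex.I)‖ ≤ |x - y| := by
  have : Complex.exp (x * Complex.I) - Complex.exp (y * Complex.I)
      = Complex.exp (y * Complex.I) * (Complex.exp (Complex.I * (x - y : ℝ)) - 1) := by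
    rw [mul_sub, ← Complex.exp_add, mul_one]
    congr 2
    push_cast
    ring
  rw [this, norm_mul, Complex.norm_exp_ofReal_mul_I, one_mul]
  exact Real.norm_exp_I_mul_ofReal_sub_one_le

/-- A perturbation that vanishes in probability does not change the limit of the characteristic
functions. -/
lemma tendsto_charFun_of_tendstoInProb_sub {X Y : ∀ k, Ω k → ℝ} (hX : ∀ k, Measurable (X k))
    (hY : ∀ k, Measurable (Y k)) (hXY : TendstoInProb P (fun k ω => Y k ω - X k ω) 0)
    {u : ℝ} {c : ℂ} (h : Tendsto (fun k => charFun ((P k).map (X k)) u) atTop (𝓝 c)) :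
    Tendsto (fun k => charFun ((P k).map (Y k)) u) atTop (𝓝 c) := by
  suffices hd : Tendsto (fun k => charFun ((P k).map (Y k)) u - charFun ((P k).map (X k)) u)
      atTop (𝓝 0) by simpa using hd.add h
  rw [Metric.tendsto_atTop]
  intro ε hε
  -- Off `B` the integrand is at most `|u| * η ≤ ε / 4`; on `B` it is at most `2`, and `B` has mass
  -- below `ε / 4`. The total stays below `ε`.
  set η := ε / (4 * (|u| + 1)) with hη
  have hη0 : 0 < η := by positivity
  have hB := tendsto_measureReal_zero (hXY η hη0)
  obtain ⟨K, hK⟩ := Metric.tendsto_atTop.1 hB (ε / 4) (by positivity)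
  refine ⟨K, fun k hk => ?_⟩
  have hBk := hK k hk
  simp only [sub_zero] at hBk
  set B := {ω | η ≤ |Y k ω - X k ω|} with hBdef
  rw [Real.dist_eq, sub_zero, abs_of_nonneg measureReal_nonneg] at hBk
  have hBm : MeasurableSet B :=
    measurableSet_le measurable_const ((hY k).sub (hX k)).abs
  have hch : ∀ V : Ω k → ℝ, Measurable V → charFun ((P k).map V) u =
      ∫ ω, Complex.exp ((u * V ω : ℝ) * Complex.I) ∂P k := by
    intro V hV
    rw [charFun_apply_real, integral_map hV.aemeasurable (by fun_prop)]
    push_cast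
    rfl
  have hi : ∀ V : Ω k → ℝ, Measurable V →
      Integrable (fun ω => Complex.exp ((u * V ω : ℝ) * Complex.I)) (P k) := by
    intro V hV
    refine Integrable.of_bound (by fun_prop) 1 (ae_of_all _ fun ω => ?_)
    rw [Complex.norm_exp_ofReal_mul_I]
  rw [dist_zero_right, hch _ (hX k), hch _ (hY k), ← integral_sub (hi _ (hY k)) (hi _ (hX k))]
  have hbound : ∀ ω, ‖Complex.exp ((u * Y k ω : ℝ) * Complex.I) -
      Complex.exp ((u * X k ω : ℝ) * Complex.I)‖ ≤ ε / 4 + B.indicator (fun _ => (2 : ℝ)) ω := by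
    intro ω
    by_cases hω : ω ∈ B
    · rw [Set.indicator_of_mem hω]
      refine (norm_sub_le _ _).trans ?_
      rw [Complex.norm_exp_ofReal_mul_I, Complex.norm_exp_ofReal_mul_I]
      linarith
    · rw [Set.indicator_of_notMem hω, add_zero]
      refine (norm_exp_ofReal_mul_I_sub_le _ _).trans ?_
      have hlt : |Y k ω - X k ω| ≤ η := (not_le.1 hω).le
      rw [← mul_sub, abs_mul]
      calc |u| * |Y k ω - X k ω| ≤ (|u| + 1) * η := by gcongr; linarith
        _ = ε / 4 := by rw [hη]; field_simp
  refine (norm_integral_le_of_norm_le (((integrable_const _).add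
    ((integrable_const _).indicator hBm))) (ae_of_all _ hbound)).trans_lt ?_
  rw [integral_add' (integrable_const _) ((integrable_const _).indicator hBm),
    integral_indicator_const _ hBm]
  simp only [integral_const, probReal_univ, smul_eq_mul]
  linarith

/-- Random variables with convergent characteristic functions are bounded in probability. -/
lemma exists_measure_le_of_tendsto_charFun {X : ∀ k, Ω k → ℝ} (hX : ∀ k, Measurable (X k))
    {ρ : Measure ℝ} [IsProbabilityMeasure ρ]
    (h : ∀ u, Tendsto (fun k => charFun ((P k).map (X k)) u) atTop (𝓝 (charFun ρ u)))
    {ε : ENNReal} (hε : 0 < ε) : ∃ M : ℝ, 0 < M ∧ ∀ k, P k {ω | M ≤ |X k ω|} ≤ ε := by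
  have (k : ℕ) : IsProbabilityMeasure ((P k).map (X k)) :=
    Measure.isProbabilityMeasure_map (hX k).aemeasurable
  -- Convergence to a function continuous at `0` yields tightness, and so a single `M` for all `k`.
  have ht := isTightMeasureSet_of_tendsto_charFun (μ := fun k => (P k).map (X k))
    (f := charFun ρ) (by fun_prop) h
  obtain ⟨K, hK, hKε⟩ := isTightMeasureSet_iff_exists_isCompact_measure_compl_le.1 ht ε hε
  obtain ⟨r, hr⟩ := hK.isBounded.exists_norm_le
  refine ⟨max r 0 + 1, by positivity, fun k => ?_⟩
  refine le_trans ?_ (hKε _ ⟨k, rfl⟩)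
  refine le_trans (measure_mono ?_) (Measure.le_map_apply (hX k).aemeasurable _)
  intro ω hω hωK
  have h1 := hr _ hωK
  rw [Real.norm_eq_abs] at h1
  have h2 : max r 0 + 1 ≤ |X k ω| := hω
  linarith [le_max_left r 0]

end Sequences

/-! ### Stability of the weights and algebra of the interval -/

/-- The identity `(√v' - √v)(√v' + √v) = v' - v` carries the relative error `δ` over to the square
root. Inverting costs a factor `√v / √v'`, at most `2` because `δ ≤ 1 / 2`. -/
lemma abs_one_div_sqrt_sub_le {v v' δ : ℝ} (hv : 0 < v) (hδ : 0 < δ) (hδ' : δ ≤ 1 / 2)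
    (h : |v' - v| ≤ δ * v) : |1 / √v' - 1 / √v| ≤ 2 * δ * (1 / √v) := by
  have hv' : v / 4 ≤ v' := by nlinarith [(abs_le.1 h).1]
  have ha : 0 < √v := Real.sqrt_pos.2 hv
  have hb : √v / 2 ≤ √v' := by
    refine Real.le_sqrt_of_sq_le ?_
    rw [div_pow, Real.sq_sqrt hv.le]
    linarith
  have hb0 : 0 < √v' := by linarith
  have hsub : |√v' - √v| ≤ δ * √v := by
    have h1 : (√v' - √v) * (√v' + √v) = v' - v := by
      have := Real.mul_self_sqrt hv.le
      have := Real.mul_self_sqrt (show 0 ≤ v' by linarith)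
      linarith
    have h2 : |√v' - √v| * (√v' + √v) ≤ δ * v := by
      rw [← abs_of_pos (add_pos hb0 ha), ← abs_mul, h1]
      exact h
    have hvv : v = √v * √v := (Real.mul_self_sqrt hv.le).symm
    have h3 : |√v' - √v| * √v ≤ |√v' - √v| * (√v' + √v) := by gcongr; linarith
    by_contra! hcon
    have h4 := mul_lt_mul_of_pos_right hcon ha
    have h5 : δ * √v * √v = δ * v := by rw [mul_assoc, ← hvv]
    linarith
  rw [div_sub_div _ _ hb0.ne' ha.ne', abs_div, abs_of_pos (mul_pos hb0 ha), mul_one_div,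
    div_le_div_iff₀ (mul_pos hb0 ha) ha, one_mul, mul_one, abs_sub_comm]
  calc |√v' - √v| * √v ≤ δ * √v * √v := by gcongr
    _ ≤ 2 * δ * (√v' * √v) := by nlinarith [mul_pos hδ ha]

namespace BatchedData

section Single

variable {T : ℕ} {Ω : Type*} [MeasurableSpace Ω] {E : BatchedData T Ω}
  {μ : Fin T → Fin 2 → ℝ} {ω : Ω} {t : Fin T} {Δ : ℝ}

lemma armMean_eq_add_errMean {a : Fin 2} (hN : 0 < E.N t a ω) :
    E.armMean t a ω = μ t a + E.errMean μ t a ω := by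
  have : (E.N t a ω : ℝ) ≠ 0 := by exact_mod_cast hN.ne'
  simp only [armMean, errMean, error, Finset.sum_sub_distrib, Finset.sum_const, Finset.card_range,
    nsmul_eq_mul]
  field_simp
  ring

lemma periodVar_pos {s : Fin T → Fin 2 → Ω → ℝ} (hN : ∀ a, 0 < E.N t a ω)
    (hs : ∀ a, 0 < s t a ω) : 0 < E.periodVar s t ω := by
  have h1 : (0 : ℝ) < E.N t 1 ω := by exact_mod_cast hN 1
  have h0 : (0 : ℝ) < E.N t 0 ω := by exact_mod_cast hN 0
  exact add_pos (div_pos (hs 1) h1) (div_pos (hs 0) h0)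

lemma weight_pos {s : Fin T → Fin 2 → Ω → ℝ} (hN : ∀ a, 0 < E.N t a ω)
    (hs : ∀ a, 0 < s t a ω) : 0 < E.weight s t ω :=
  one_div_pos.2 (Real.sqrt_pos.2 (periodVar_pos hN hs))

/-- A relative error of the variances bounds the relative error of the weight. -/
lemma abs_weight_sub_le {s s' : Fin T → Fin 2 → Ω → ℝ} {δ : ℝ} (hδ : 0 < δ) (hδ' : δ ≤ 1 / 2)
    (hN : ∀ a, 0 < E.N t a ω) (hs : ∀ a, 0 < s t a ω)
    (hss : ∀ a, |s' t a ω - s t a ω| ≤ δ * s t a ω) :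
    |E.weight s' t ω - E.weight s t ω| ≤ 2 * δ * E.weight s t ω := by
  refine abs_one_div_sqrt_sub_le (periodVar_pos hN hs) hδ hδ' ?_
  have h1 : (0 : ℝ) < E.N t 1 ω := by exact_mod_cast hN 1
  have h0 : (0 : ℝ) < E.N t 0 ω := by exact_mod_cast hN 0
  have : E.periodVar s' t ω - E.periodVar s t ω =
      (s' t 1 ω - s t 1 ω) / E.N t 1 ω + (s' t 0 ω - s t 0 ω) / E.N t 0 ω := by
    simp only [periodVar]
    ring
  rw [this, periodVar, mul_add, ← mul_div_assoc, ← mul_div_assoc]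
  refine (abs_add_le _ _).trans ?_
  rw [abs_div, abs_div, abs_of_pos h1, abs_of_pos h0]
  gcongr
  · exact hss 1
  · exact hss 0

/-- The effect lies in the confidence interval iff the studentized error of the weighted
estimate is at most `z` in absolute value. -/
lemma mem_confInterval_iff (hT : 0 < T) {s : Fin T → Fin 2 → Ω → ℝ}
    (hΔ : ∀ t, μ t 1 - μ t 0 = Δ) (hN : ∀ t a, 0 < E.N t a ω) (hs : ∀ t a, 0 < s t a ω) (z : ℝ) :
    Δ ∈ E.confInterval s z ω ↔
      (√(T : ℝ))⁻¹ * ∑ t, E.weight s t ω * (E.errMean μ t 1 ω - E.errMean μ t 0 ω) ∈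
        Set.Icc (-z) z := by
  have : Nonempty (Fin T) := ⟨⟨0, hT⟩⟩
  have hT' : (0 : ℝ) < √(T : ℝ) := Real.sqrt_pos.2 (by exact_mod_cast hT)
  have hS : 0 < E.weightSum s ω :=
    Finset.sum_pos (fun t _ => weight_pos (hN t) (hs t)) Finset.univ_nonempty
  have hest : E.weightedEstimator s ω = Δ + (E.weightSum s ω)⁻¹ *
      ∑ t, E.weight s t ω * (E.errMean μ t 1 ω - E.errMean μ t 0 ω) := by
    have hd : ∀ t, E.diffMeans t ω = Δ + (E.errMean μ t 1 ω - E.errMean μ t 0 ω) := by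
      intro t
      rw [diffMeans, armMean_eq_add_errMean (μ := μ) (hN t 1),
        armMean_eq_add_errMean (μ := μ) (hN t 0), ← hΔ t]
      ring
    have h1 : ∑ t, E.weight s t ω / E.weightSum s ω * Δ = Δ := by
      rw [← Finset.sum_mul, ← Finset.sum_div, ← weightSum, div_self hS.ne', one_mul]
    simp only [weightedEstimator, hd, mul_add, Finset.sum_add_distrib, h1, Finset.mul_sum]
    congr 1
    refine Finset.sum_congr rfl fun t _ => ?_
    ring
  set R := ∑ t, E.weight s t ω * (E.errMean μ t 1 ω - E.errMean μ t 0 ω)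
  simp only [confInterval, stdError, Set.mem_Icc, hest]
  set S := E.weightSum s ω
  rw [inv_mul_eq_div, inv_mul_eq_div, le_div_iff₀ hT', div_le_iff₀ hT', ← mul_div_assoc]
  have e1 : Δ + R / S - z * √(T : ℝ) / S ≤ Δ ↔ R ≤ z * √(T : ℝ) := by
    rw [add_sub_assoc, ← sub_div, add_le_iff_nonpos_right, div_le_iff₀ hS, zero_mul, sub_nonpos]
  have e2 : Δ ≤ Δ + R / S + z * √(T : ℝ) / S ↔ -z * √(T : ℝ) ≤ R := by
    rw [add_assoc, ← add_div, le_add_iff_nonneg_right, le_div_iff₀ hS, zero_mul, neg_mul,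
      neg_le_iff_add_nonneg]
  rw [e1, e2, and_comm]

end Single

/-! ### Asymptotic normality of the standardized errors -/

section Limit

variable {T : ℕ} {Ω : ℕ → Type*} [∀ k, MeasurableSpace (Ω k)]
  {P : ∀ k, Measure (Ω k)} {E : ∀ k, BatchedData T (Ω k)}
  {μ : Fin T → Fin 2 → ℝ} {ν : Fin T → Fin 2 → Measure ℝ} {σsq : Fin T → Fin 2 → ℝ}

variable {σhat : ∀ k, Fin T → Fin 2 → Ω k → ℝ}

/-- With probability tending to one, all arms are non-empty and all variance estimates have a
relative error below `δ`. -/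
lemma tendsto_measure_bad (hσ : ∀ t a, 0 < σsq t a)
    (hN : ∀ t a, TendstoInfInProb P (fun k => (E k).N t a))
    (hσhat : ∀ t a, TendstoInProb P (fun k => σhat k t a) (σsq t a)) {δ : ℝ} (hδ : 0 < δ) :
    Tendsto (fun k => P k {ω | ¬ ∀ t a, 0 < (E k).N t a ω ∧
      |σhat k t a ω - σsq t a| < δ * σsq t a}) atTop (𝓝 0) := by
  -- The threshold `0` in `hN` describes an empty arm.
  have h := tendsto_measure_iUnion (P := P) (ι := Fin T × Fin 2)
    fun p => tendsto_measure_union (hN p.1 p.2 0)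
      (hσhat p.1 p.2 (δ * σsq p.1 p.2) (mul_pos hδ (hσ _ _)))
  refine h.congr fun k => congrArg _ ?_
  ext ω
  simp only [Set.mem_iUnion, Set.mem_union, Set.mem_ofPred_eq, Prod.exists, not_forall, not_and_or,
    not_lt]

/-- Finite sums preserve convergence to zero in probability. -/
lemma _root_.TendstoInProb.const_mul_sum {ι : Type*} [Fintype ι] [Nonempty ι]
    {X : ι → ∀ k, Ω k → ℝ} (hX : ∀ i, TendstoInProb P (X i) 0) {c : ℝ} (hc : 0 < c) :
    TendstoInProb P (fun k ω => c * ∑ i, X i k ω) 0 := by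
  intro η hη
  have hcard : (0 : ℝ) < Fintype.card ι := by exact_mod_cast Fintype.card_pos
  have h := tendsto_measure_iUnion (P := P)
    fun i => hX i (η / (c * Fintype.card ι)) (by positivity)
  refine tendsto_of_tendsto_of_tendsto_of_le_of_le tendsto_const_nhds h (fun _ => zero_le)
    fun k => measure_mono fun ω hω => ?_
  by_contra! hcon
  simp only [Set.mem_iUnion, Set.mem_ofPred_eq, not_exists, not_le, sub_zero] at hcon hω
  rw [abs_mul, abs_of_pos hc] at hω
  have : ∑ i, |X i k ω| < ∑ _i : ι, η / (c * Fintype.card ι) :=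
    Finset.sum_lt_sum_of_nonempty Finset.univ_nonempty fun i _ => hcon i
  rw [Finset.sum_const, Finset.card_univ, nsmul_eq_mul] at this
  have h2 := mul_lt_mul_of_pos_left ((Finset.abs_sum_le_sum_abs _ _).trans_lt this) hc
  have h3 : c * (Fintype.card ι * (η / (c * Fintype.card ι))) = η := by field_simp
  linarith

variable [∀ k, IsProbabilityMeasure (P k)]

/-- Conditionally on the history, the standardized estimation error of a period is asymptotically
standard normal. -/
lemma tendsto_integral_mul_exp_stdDiff_sub (hσ : ∀ t a, 0 < σsq t a)
    (hν : ∀ t a, IsCenteredLaw (ν t a) (σsq t a)) (hE : ∀ k, (E k).IsAdaptive (P k) μ ν)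
    (hN : ∀ t a, TendstoInfInProb P (fun k => (E k).N t a)) (t : Fin T) (u : ℝ)
    {A : ∀ k, Ω k → ℂ} (hA : ∀ k, Measurable[(E k).history t] (A k))
    (hA1 : ∀ k ω, ‖A k ω‖ ≤ 1) :
    Tendsto (fun k => ∫ ω, A k ω * Complex.exp (u * (E k).stdDiff μ σsq t ω * Complex.I) ∂P k -
      (∫ ω, A k ω ∂P k) * Complex.exp (-(u ^ 2 / 2 : ℝ))) atTop (𝓝 0) := by
  have := fun a => (hν t a).isProb
  rw [Metric.tendsto_atTop]
  intro ε hε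
  -- Sizes above `M` contribute at most `ε / 4`. The remaining event has mass below `ε / 4`, with
  -- integrand at most `2`.
  obtain ⟨M, hM⟩ := norm_diffCharFun_sub_le (hν t 1) (hν t 0) (hσ t 1) (hσ t 0) u
    (show 0 < ε / 4 by positivity)
  have hB := tendsto_measureReal_zero (tendsto_measure_union (hN t 1 M) (hN t 0 M))
  obtain ⟨K, hK⟩ := Metric.tendsto_atTop.1 hB (ε / 4) (by positivity)
  refine ⟨K, fun k hk => ?_⟩
  have hBk := hK k hk
  set B := {ω | (E k).N t 1 ω ≤ M} ∪ {ω | (E k).N t 0 ω ≤ M} with hBdef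
  rw [Real.dist_eq, sub_zero, abs_of_nonneg measureReal_nonneg] at hBk
  have hBm : MeasurableSet B := ((E k).measurable_N t 1 measurableSet_Iic).union
    ((E k).measurable_N t 0 measurableSet_Iic)
  have hAm : Measurable (A k) := (hA k).mono ((E k).history_le t) le_rfl
  set φ := diffCharFun (ν t 1) (ν t 0) (σsq t 1) (σsq t 0) u with hφ
  set e := Complex.exp (-(u ^ 2 / 2 : ℝ)) with he
  have he1 : ‖e‖ ≤ 1 := by
    rw [he, ← Complex.ofReal_neg, ← Complex.ofReal_exp, Complex.norm_real, Real.norm_of_nonneg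
      (Real.exp_nonneg _), Real.exp_le_one_iff, neg_nonpos]
    positivity
  have hφ1 : ∀ n, ‖φ n‖ ≤ 1 := fun n => norm_diffCharFun_le_one _ _ _ _ _ _
  have hφm : Measurable fun ω => φ ((E k).N t 1 ω, (E k).N t 0 ω) :=
    (Measurable.of_discrete (f := φ)).comp
      (((E k).measurable_N t 1).prodMk ((E k).measurable_N t 0))
  rw [dist_zero_right, (hE k).integral_mul_exp_stdDiff t u (hA k) (hA1 k), ← integral_mul_const,
    ← integral_sub]
  rotate_left
  · refine Integrable.of_bound (hAm.mul hφm).aestronglyMeasurable 1 (ae_of_all _ fun ω => ?_)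
    rw [norm_mul]
    exact mul_le_one₀ (hA1 k ω) (norm_nonneg _) (hφ1 _)
  · exact (Integrable.of_bound hAm.aestronglyMeasurable 1 (ae_of_all _ (hA1 k))).mul_const _
  have hbound : ∀ ω, ‖A k ω * φ ((E k).N t 1 ω, (E k).N t 0 ω) - A k ω * e‖ ≤
      ε / 4 + B.indicator (fun _ => (2 : ℝ)) ω := by
    intro ω
    rw [← mul_sub, norm_mul]
    have h1 : ‖A k ω‖ * ‖φ ((E k).N t 1 ω, (E k).N t 0 ω) - e‖ ≤
        1 * ‖φ ((E k).N t 1 ω, (E k).N t 0 ω) - e‖ := by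
      gcongr
      exact hA1 k ω
    refine h1.trans ?_
    rw [one_mul]
    by_cases hω : ω ∈ B
    · rw [Set.indicator_of_mem hω]
      refine (norm_sub_le _ _).trans ?_
      linarith [hφ1 ((E k).N t 1 ω, (E k).N t 0 ω)]
    · rw [Set.indicator_of_notMem hω, add_zero]
      simp only [hBdef, Set.mem_union, Set.mem_ofPred_eq, not_or, not_le] at hω
      exact hM _ hω.1 hω.2
  refine (norm_integral_le_of_norm_le (((integrable_const _).add
    ((integrable_const _).indicator hBm))) (ae_of_all _ hbound)).trans_lt ?_
  rw [integral_add' (integrable_const _) ((integrable_const _).indicator hBm),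
    integral_indicator_const _ hBm]
  simp only [integral_const, probReal_univ, smul_eq_mul]
  linarith

lemma stdDiff_measurable (E : ∀ k, BatchedData T (Ω k)) (k : ℕ) (t : Fin T) :
    Measurable ((E k).stdDiff μ σsq t) :=
  (E k).measurable_stdDiff μ σsq ((E k).measurable_N t) ((E k).measurable_observed t)

/-- The case `A = 1` of the conditional limit; it supplies the tightness of each `Z_t`. -/
lemma tendsto_charFun_stdDiff (hσ : ∀ t a, 0 < σsq t a)
    (hν : ∀ t a, IsCenteredLaw (ν t a) (σsq t a)) (hE : ∀ k, (E k).IsAdaptive (P k) μ ν)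
    (hN : ∀ t a, TendstoInfInProb P (fun k => (E k).N t a)) (t : Fin T) (u : ℝ) :
    Tendsto (fun k => charFun ((P k).map ((E k).stdDiff μ σsq t)) u) atTop
      (𝓝 (charFun (gaussianReal 0 1) u)) := by
  have h := tendsto_integral_mul_exp_stdDiff_sub hσ hν hE hN t u
    (A := fun _ _ => 1) (fun _ => measurable_const) (by simp)
  have h' := h.add_const (Complex.exp (-(u ^ 2 / 2 : ℝ)))
  have hg : charFun (gaussianReal 0 1) u = 0 + Complex.exp (-(u ^ 2 / 2 : ℝ)) := by
    rw [charFun_gaussianReal]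
    simp
  rw [hg]
  refine h'.congr fun k => ?_
  rw [charFun_apply_real,
    integral_map (stdDiff_measurable E k t).aemeasurable (by fun_prop)]
  simp

/-- The standardized estimation errors of the periods are jointly asymptotically independent. -/
lemma tendsto_integral_exp_sum_stdDiff (hσ : ∀ t a, 0 < σsq t a)
    (hν : ∀ t a, IsCenteredLaw (ν t a) (σsq t a)) (hE : ∀ k, (E k).IsAdaptive (P k) μ ν)
    (hN : ∀ t a, TendstoInfInProb P (fun k => (E k).N t a)) (u : ℝ) {j : ℕ} (hj : j ≤ T) :
    Tendsto (fun k => ∫ ω, Complex.exp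
      ((u * ∑ t : Fin T with t.val < j, (E k).stdDiff μ σsq t ω : ℝ) * Complex.I) ∂P k) atTop
      (𝓝 (Complex.exp (-(u ^ 2 / 2 : ℝ)) ^ j)) := by
  induction j with
  | zero => simp
  | succ j ih =>
    have ih := ih (by omega)
    let t : Fin T := ⟨j, hj⟩
    -- The factor `A` collects the periods strictly before `t`; it is history-measurable because
    -- their sizes and observed outcomes are.
    have h := tendsto_integral_mul_exp_stdDiff_sub hσ hν hE hN t u
      (A := fun k ω => Complex.exp
        ((u * ∑ s : Fin T with s.val < j, (E k).stdDiff μ σsq s ω : ℝ) * Complex.I)) (fun k => by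
          have hs : Measurable[(E k).history t]
              fun ω => ∑ s : Fin T with s.val < j, (E k).stdDiff μ σsq s ω := by
            refine Finset.measurable_fun_sum _ fun s hs => ?_
            have hst : s < t := (Finset.mem_filter.1 hs).2
            exact (E k).measurable_stdDiff μ σsq ((E k).measurable_N_history hst.le)
              ((E k).measurable_observed_history hst)
          exact (show Measurable fun x : ℝ => Complex.exp ((u * x : ℝ) * Complex.I)
            by fun_prop).comp hs)
      (fun k ω => by rw [Complex.norm_exp_ofReal_mul_I])
    have h' := h.add (ih.mul_const (Complex.exp (-(u ^ 2 / 2 : ℝ))))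
    rw [zero_add, ← pow_succ] at h'
    refine h'.congr fun k => ?_
    rw [sub_add_cancel]
    congr 1
    ext ω
    rw [← Complex.exp_add]
    congr 1
    have hset : ({s : Fin T | s.val < j + 1} : Finset (Fin T)) =
        insert t ({s : Fin T | s.val < j} : Finset (Fin T)) := by
      ext s
      simp only [Finset.mem_filter, Finset.mem_univ, true_and, Finset.mem_insert, Fin.ext_iff, t]
      omega
    rw [hset, Finset.sum_insert (by simp [t])]
    push_cast
    ring

/-- Central limit theorem for the standardized estimation errors. -/
lemma tendsto_charFun_sum_stdDiff (hT : 0 < T) (hσ : ∀ t a, 0 < σsq t a)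
    (hν : ∀ t a, IsCenteredLaw (ν t a) (σsq t a)) (hE : ∀ k, (E k).IsAdaptive (P k) μ ν)
    (hN : ∀ t a, TendstoInfInProb P (fun k => (E k).N t a)) (u : ℝ) :
    Tendsto (fun k => charFun ((P k).map fun ω =>
      (√(T : ℝ))⁻¹ * ∑ t, (E k).stdDiff μ σsq t ω) u) atTop
      (𝓝 (charFun (gaussianReal 0 1) u)) := by
  -- At the argument `u / √T`, the `T` equal Gaussian factors multiply to `exp(-u²/2)`.
  have h := tendsto_integral_exp_sum_stdDiff hσ hν hE hN (u * (√(T : ℝ))⁻¹) le_rfl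
  have hT' : (0 : ℝ) < T := by exact_mod_cast hT
  have hg : charFun (gaussianReal 0 1) u =
      Complex.exp (-((u * (√(T : ℝ))⁻¹) ^ 2 / 2 : ℝ)) ^ T := by
    rw [charFun_gaussianReal, ← Complex.exp_nat_mul, mul_pow, inv_pow, Real.sq_sqrt hT'.le]
    congr 1
    push_cast
    have : (T : ℂ) ≠ 0 := by exact_mod_cast hT.ne'
    field_simp
    simp [sq]
  rw [hg]
  refine h.congr fun k => ?_
  have hm : Measurable fun ω => (√(T : ℝ))⁻¹ * ∑ t, (E k).stdDiff μ σsq t ω :=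
    (Finset.measurable_fun_sum _ fun t _ => stdDiff_measurable E k t).const_mul _
  rw [charFun_apply_real, integral_map hm.aemeasurable (by fun_prop)]
  congr 1
  ext ω
  simp only [Fin.is_lt, Finset.filter_true]
  push_cast
  ring_nf

/-- The estimated weights may be replaced by the true ones. -/
lemma tendstoInProb_weight_mul_sub_stdDiff (hσ : ∀ t a, 0 < σsq t a)
    (hν : ∀ t a, IsCenteredLaw (ν t a) (σsq t a)) (hE : ∀ k, (E k).IsAdaptive (P k) μ ν)
    (hN : ∀ t a, TendstoInfInProb P (fun k => (E k).N t a))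
    (hσhat : ∀ t a, TendstoInProb P (fun k => σhat k t a) (σsq t a)) (t : Fin T) :
    TendstoInProb P (fun k ω => (E k).weight (σhat k) t ω *
      ((E k).errMean μ t 1 ω - (E k).errMean μ t 0 ω) - (E k).stdDiff μ σsq t ω) 0 := by
  intro η hη
  rw [ENNReal.tendsto_nhds_zero]
  intro ε hε
  obtain ⟨M, hM0, hM⟩ := exists_measure_le_of_tendsto_charFun
    (fun k => stdDiff_measurable E k t) (tendsto_charFun_stdDiff hσ hν hE hN t)
    (ENNReal.half_pos hε.ne')
  -- A weight error of relative size `2 * δ` on `|Z_t| < M` moves the term by less than `2 * δ * M ≤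
  -- η / 2`; the bound `1 / 2` is required by `abs_weight_sub_le`.
  set δ := min (1 / 2) (η / (4 * M)) with hδdef
  have hδ : 0 < δ := by positivity
  have hδM : 2 * δ * M < η := by
    have : δ ≤ η / (4 * M) := min_le_right _ _
    rw [le_div_iff₀ (by positivity)] at this
    linarith
  filter_upwards [ENNReal.tendsto_nhds_zero.1
    (tendsto_measure_bad (E := E) hσ hN hσhat hδ) _ (ENNReal.half_pos hε.ne')] with k hk
  rw [← ENNReal.add_halves ε]
  refine le_trans (measure_mono ?_) ((measure_union_le _ _).trans (add_le_add hk (hM k)))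
  intro ω hω
  by_contra hcon
  simp only [Set.mem_union, Set.mem_ofPred_eq, not_or, not_not, not_le, sub_zero] at hcon hω
  obtain ⟨hgood, hZ⟩ := hcon
  have hw := abs_weight_sub_le (E := E k) (s := fun t a _ => σsq t a) (s' := σhat k) hδ
    (min_le_left _ _) (fun a => (hgood t a).1) (fun a => hσ t a) fun a => (hgood t a).2.le
  rw [stdDiff] at hω hZ
  have hwpos : 0 < (E k).weight (fun t a _ => σsq t a) t ω :=
    weight_pos (fun a => (hgood t a).1) fun a => hσ t a
  rw [← sub_mul, abs_mul] at hω
  rw [abs_mul, abs_of_pos hwpos] at hZ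
  have := mul_le_mul_of_nonneg_right hw
    (abs_nonneg ((E k).errMean μ t 1 ω - (E k).errMean μ t 0 ω))
  rw [mul_assoc] at this
  have := mul_lt_mul_of_pos_left hZ (show 0 < 2 * δ by positivity)
  linarith

end Limit

end BatchedData

/-! ### The limit of the coverage probability -/

theorem corollary1 {T : ℕ} (hT : 0 < T)
    {Ω : ℕ → Type*} [∀ k, MeasurableSpace (Ω k)]
    (P : ∀ k, Measure (Ω k)) [∀ k, IsProbabilityMeasure (P k)]
    (E : ∀ k, BatchedData T (Ω k))
    (μ : Fin T → Fin 2 → ℝ) (ν : Fin T → Fin 2 → Measure ℝ) (σsq : Fin T → Fin 2 → ℝ)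
    (Δ : ℝ)
    -- the treatment effect is the same in all periods
    (hΔ : ∀ t, μ t 1 - μ t 0 = Δ)
    -- the errors have mean zero and positive finite arm- and period-specific variances
    (hσ : ∀ t a, 0 < σsq t a)
    (hν : ∀ t a, IsCenteredLaw (ν t a) (σsq t a))
    (hE : ∀ k, (E k).IsAdaptive (P k) μ ν)
    -- in each period the number of units in each arm grows without bound
    (hN : ∀ t a, TendstoInfInProb P (fun k => (E k).N t a))
    -- consistent variance estimators
    (σhat : ∀ k, Fin T → Fin 2 → Ω k → ℝ)
    (hσhat_meas : ∀ k t a, Measurable (σhat k t a))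
    (hσhat : ∀ t a, TendstoInProb P (fun k => σhat k t a) (σsq t a))
    (α : ℝ) (hα : α ∈ Set.Ioo (0 : ℝ) 1) :
    Tendsto
      (fun k => (P k).real
        {ω | Δ ∈ (E k).confInterval (σhat k) (stdNormalQuantile (1 - α / 2)) ω})
      atTop (𝓝 (1 - α)) := by
  let X : ∀ k, Ω k → ℝ := fun k ω => (√(T : ℝ))⁻¹ * ∑ t, (E k).stdDiff μ σsq t ω
  let Y : ∀ k, Ω k → ℝ := fun k ω => (√(T : ℝ))⁻¹ * ∑ t, (E k).weight (σhat k) t ω *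
    ((E k).errMean μ t 1 ω - (E k).errMean μ t 0 ω)
  have : Nonempty (Fin T) := ⟨⟨0, hT⟩⟩
  have hc : (0 : ℝ) < (√(T : ℝ))⁻¹ := inv_pos.2 (Real.sqrt_pos.2 (by exact_mod_cast hT))
  have hX : ∀ k, Measurable (X k) := fun k =>
    (Finset.measurable_fun_sum _ fun t _ => BatchedData.stdDiff_measurable E k t).const_mul _
  have hY : ∀ k, Measurable (Y k) := fun k =>
    (Finset.measurable_fun_sum _ fun t _ =>
      ((E k).measurable_weight (hσhat_meas k t) ((E k).measurable_N t)).mul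
        (((E k).measurable_errMean μ ((E k).measurable_N t 1)
          ((E k).measurable_observed t 1)).sub
        ((E k).measurable_errMean μ ((E k).measurable_N t 0)
          ((E k).measurable_observed t 0)))).const_mul _
  have hXY : TendstoInProb P (fun k ω => Y k ω - X k ω) 0 := by
    have h := TendstoInProb.const_mul_sum
      (BatchedData.tendstoInProb_weight_mul_sub_stdDiff hσ hν hE hN hσhat) hc
    have heq : (fun k ω => Y k ω - X k ω) = fun k ω => (√(T : ℝ))⁻¹ * ∑ t,
        ((E k).weight (σhat k) t ω * ((E k).errMean μ t 1 ω - (E k).errMean μ t 0 ω) -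
          (E k).stdDiff μ σsq t ω) := by
      ext k ω
      rw [Finset.sum_sub_distrib, mul_sub]
    rw [heq]
    exact h
  have hchar : ∀ u, Tendsto (fun k => charFun ((P k).map (Y k)) u) atTop
      (𝓝 (charFun (gaussianReal 0 1) u)) := fun u =>
    tendsto_charFun_of_tendstoInProb_sub hX hY hXY
      (BatchedData.tendsto_charFun_sum_stdDiff hT hσ hν hE hN u)
  set z := stdNormalQuantile (1 - α / 2) with hz
  have hlim : Tendsto (fun k => (P k).real (Y k ⁻¹' Set.Icc (-z) z)) atTop (𝓝 (1 - α)) := by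
    let ρ : ℕ → ProbabilityMeasure ℝ := fun k =>
      ⟨(P k).map (Y k), Measure.isProbabilityMeasure_map (hY k).aemeasurable⟩
    let γ : ProbabilityMeasure ℝ := ⟨gaussianReal 0 1, inferInstance⟩
    have hρ : Tendsto ρ atTop (𝓝 γ) := ProbabilityMeasure.tendsto_of_tendsto_charFun hchar
    have : NullSingletonClass (γ : Measure ℝ) := nullSingletonClass_gaussianReal (μ := 0) one_ne_zero
    have hfr : (γ : Measure ℝ) (frontier (Set.Icc (-z) z)) = 0 := by
      refine measure_mono_null (t := {-z, z}) ?_ ((Set.toFinite _).measure_zero _)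
      -- The sign of `z` is not needed here: a reversed interval is empty and has empty frontier.
      rcases le_or_gt (-z) z with h | h
      · rw [frontier_Icc h]
      · simp [Set.Icc_eq_empty h.not_ge]
    have h := (ENNReal.tendsto_toReal (measure_ne_top _ _)).comp
      (ProbabilityMeasure.tendsto_measure_of_null_frontier_of_tendsto' hρ hfr)
    rw [← gaussianReal_Icc_stdNormalQuantile hα]
    refine h.congr fun k => ?_
    exact map_measureReal_apply (hY k) measurableSet_Icc
  -- A relative error below `1 / 2` already makes the variance estimates positive. Off this bad
  -- event, coverage and `Y k ω ∈ Icc (-z) z` are equivalent, so their probabilities differ by at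
  -- most its mass.
  have hbad := tendsto_measureReal_zero
    (BatchedData.tendsto_measure_bad (E := E) hσ hN hσhat one_half_pos)
  refine (tendsto_iff_of_dist (f₂ := fun k => (P k).real (Y k ⁻¹' Set.Icc (-z) z)) ?_).2 hlim
  refine squeeze_zero (fun _ => dist_nonneg) (fun k => ?_) hbad
  have hiff : ∀ ω, (∀ t a, 0 < (E k).N t a ω ∧ |σhat k t a ω - σsq t a| < 1 / 2 * σsq t a) →
      (Δ ∈ (E k).confInterval (σhat k) z ω ↔ Y k ω ∈ Set.Icc (-z) z) := fun ω hω =>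
    BatchedData.mem_confInterval_iff hT hΔ (fun t a => (hω t a).1) (fun t a => by
      linarith [(abs_lt.1 (hω t a).2).1, hσ t a]) z
  rw [Real.dist_eq, abs_le]
  have key : ∀ A B : Set (Ω k), (∀ ω, (∀ t a, 0 < (E k).N t a ω ∧
      |σhat k t a ω - σsq t a| < 1 / 2 * σsq t a) → ω ∈ A → ω ∈ B) →
      (P k).real A ≤ (P k).real B + (P k).real {ω | ¬ ∀ t a, 0 < (E k).N t a ω ∧
        |σhat k t a ω - σsq t a| < 1 / 2 * σsq t a} := by
    intro A B hAB
    refine (measureReal_mono (fun ω hω => ?_)).trans (measureReal_union_le _ _)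
    by_cases hg : ∀ t a, 0 < (E k).N t a ω ∧ |σhat k t a ω - σsq t a| < 1 / 2 * σsq t a
    · exact Or.inl (hAB ω hg hω)
    · exact Or.inr hg
  have k1 := key {ω | Δ ∈ (E k).confInterval (σhat k) z ω} (Y k ⁻¹' Set.Icc (-z) z)
    fun ω hg h => (hiff ω hg).1 h
  have k2 := key (Y k ⁻¹' Set.Icc (-z) z) {ω | Δ ∈ (E k).confInterval (σhat k) z ω}
    fun ω hg h => (hiff ω hg).2 h
  constructor <;> linarith
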